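/- Let $1 \le t < k$ be fixed integers and put $D = \binom{k}{t} - 1$. For $v \ge k$, the random greedy $(v,k,t)$ covering is produced as follows. Fix a uniformly random ordering of the $k$-subsets of a $v$-set. Starting with no $k$-set chosen, repeatedly choose the earliest $k$-set that contains no already-covered $t$-set (a $t$-set is covered if it is contained in a chosen $k$-set), until no $k$-set can be chosen. Finally, for each $t$-set that is still uncovered, add one $k$-set containing it (an arbitrary one; the resulting blocks are counted with multiplicity). The density of a covering is the average, over all $t$-subsets of the $v$-set, of the number of blocks containing the $t$-set. Then the expected density of the covering produced by the random greedy algorithm is $1 + O\bigl((\log v)^{-1/D}\bigr)$ as $v \to \infty$; that is, there is a constant $C$ depending only on $k$ and $t$ such that for all $v \ge k$, and whatever the choices in the final step, the expected density differs from $1$ by at most $C (\log v)^{-1/D}$. -/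

import Mathlib

open Finset
open scoped BigOperators

namespace RandomGreedy

/-- The `k`-subsets of the `v`-set `Fin v`. -/
abbrev SubsetOfCard (v k : ℕ) : Type := {K : Finset (Fin v) // K.card = k}

/-- The orderings of the `k`-subsets of `Fin v`: `σ K` is the position of `K`. -/
abbrev BlockOrder (v k : ℕ) : Type :=
  SubsetOfCard v k ≃ Fin (Fintype.card (SubsetOfCard v k))

/-- A `(v, k, t)` covering design: a family of `k`-subsets of a `v`-set (the blocks) such that
every `t`-subset is contained in at least one block. A block may occur more than once. -/
structure Covering (v k t : ℕ) where
  blocks : Multiset (SubsetOfCard v k)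
  covers : ∀ T : SubsetOfCard v t, ∃ B ∈ blocks, T.1 ⊆ B.1

/-- The density of a covering: the average, over all `t`-subsets `T`, of the number of blocks
(counted with multiplicity) that contain `T`. -/
noncomputable def Covering.density {v k t : ℕ} (𝒞 : Covering v k t) : ℝ :=
  𝔼 T : SubsetOfCard v t, ((𝒞.blocks.countP fun B => T.1 ⊆ B.1 : ℕ) : ℝ)

/-- The `k`-sets that contain no `t`-set already covered by a `k`-set in `A`. -/
def available {v k : ℕ} (t : ℕ) (A : Finset (SubsetOfCard v k)) : Finset (SubsetOfCard v k) :=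
  univ.filter fun K => ∀ T ∈ K.1.powersetCard t, ¬ ∃ B ∈ A, T ⊆ B.1

/-- The earliest element, with respect to the ordering `σ`, of a nonempty set of `k`-sets. -/
def earliest {v k : ℕ} (σ : BlockOrder v k) (S : Finset (SubsetOfCard v k)) (hS : S.Nonempty) :
    SubsetOfCard v k :=
  σ.symm ((S.image σ).min' (hS.image σ))

/-- One round of the greedy selection: choose the earliest `k`-set containing no already-covered
`t`-set; if there is none, the selection has stopped. -/
def greedyStep {v k : ℕ} (t : ℕ) (σ : BlockOrder v k) (A : Finset (SubsetOfCard v k)) :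
    Finset (SubsetOfCard v k) :=
  if h : (available t A).Nonempty then insert (earliest σ (available t A) h) A else A

/-- The `k`-sets chosen by the greedy selection, run until no `k`-set can be chosen. As many rounds
as there are `k`-sets always suffice, see `available_chosen`. -/
def chosen {v k : ℕ} (t : ℕ) (σ : BlockOrder v k) : Finset (SubsetOfCard v k) :=
  (greedyStep t σ)^[Fintype.card (SubsetOfCard v k)] ∅

theorem earliest_mem {v k : ℕ} (σ : BlockOrder v k) (S : Finset (SubsetOfCard v k))
    (hS : S.Nonempty) : earliest σ S hS ∈ S := by
  obtain ⟨K, hK, h⟩ := mem_image.1 ((S.image σ).min'_mem (hS.image σ))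
  rw [earliest, ← h, Equiv.symm_apply_apply]
  exact hK

theorem notMem_of_mem_available {v k t : ℕ} (htk : t ≤ k) {A : Finset (SubsetOfCard v k)}
    {K : SubsetOfCard v k} (hK : K ∈ available t A) : K ∉ A := by
  intro hA
  obtain ⟨T, hT⟩ := powersetCard_nonempty.2 (htk.trans_eq K.2.symm)
  exact (mem_filter.1 hK).2 T hT ⟨K, hA, (mem_powersetCard.1 hT).1⟩

/-- When the greedy selection ends, no `k`-set can be chosen any more. -/
theorem available_chosen {v k t : ℕ} (htk : t ≤ k) (σ : BlockOrder v k) :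
    available t (chosen t σ) = ∅ := by
  have key : ∀ n : ℕ, available t ((greedyStep t σ)^[n] ∅) = ∅ ∨
      ((greedyStep t σ)^[n] ∅).card = n := by
    intro n
    induction n with
    | zero => right; rfl
    | succ n ih =>
      rw [Function.iterate_succ_apply']
      generalize (greedyStep t σ)^[n] ∅ = A at ih
      by_cases h : (available t A).Nonempty
      · right
        have hcard := ih.resolve_left h.ne_empty
        rw [greedyStep, dif_pos h,
          card_insert_of_notMem (notMem_of_mem_available htk (earliest_mem σ _ h)), hcard]
      · left
        rw [greedyStep, dif_neg h]
        exact not_nonempty_iff_eq_empty.1 h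
  rcases key (Fintype.card (SubsetOfCard v k)) with h | h
  · exact h
  · have huniv : chosen t σ = univ := (card_eq_iff_eq_univ _).1 h
    rw [eq_empty_iff_forall_notMem]
    intro K hK
    exact notMem_of_mem_available htk hK (by rw [huniv]; exact mem_univ K)

/-- The `t`-sets left uncovered by the greedy selection. -/
def uncovered {v k : ℕ} (t : ℕ) (σ : BlockOrder v k) : Finset (SubsetOfCard v t) :=
  univ.filter fun T => ¬ ∃ B ∈ chosen t σ, T.1 ⊆ B.1

/-- A rule for the last step of the algorithm: for every ordering, it assigns to each `t`-set a
`k`-set containing it, to be used if the `t`-set is left uncovered by the greedy selection. -/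
structure CoverUpRule (v k t : ℕ) where
  cover : BlockOrder v k → SubsetOfCard v t → SubsetOfCard v k
  subset_cover : ∀ σ T, T.1 ⊆ (cover σ T).1

/-- The covering produced by the greedy algorithm with the ordering `σ`: the `k`-sets chosen by
the greedy selection, together with one `k`-set for each remaining `t`-set. -/
def greedyCovering {v k t : ℕ} (c : CoverUpRule v k t) (σ : BlockOrder v k) : Covering v k t where
  blocks := (chosen t σ).val + (uncovered t σ).val.map (c.cover σ)
  covers T := by
    by_cases h : ∃ B ∈ chosen t σ, T.1 ⊆ B.1
    · obtain ⟨B, hB, hTB⟩ := h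
      exact ⟨B, Multiset.mem_add.2 (Or.inl hB), hTB⟩
    · exact ⟨c.cover σ T, Multiset.mem_add.2 (Or.inr (Multiset.mem_map_of_mem _
        (mem_filter.2 ⟨mem_univ T, h⟩))), c.subset_cover σ T⟩

/-- The expected density of the covering produced by the greedy algorithm, over a uniformly random
ordering of the `k`-sets. -/
noncomputable def expectedDensity {v k t : ℕ} (c : CoverUpRule v k t) : ℝ :=
  𝔼 σ : BlockOrder v k, (greedyCovering c σ).density

end RandomGreedy

/-!
Let `D = k.choose t - 1`. The `k`-sets chosen greedily form a packing, and each uncovered `t`-set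
costs one more block. So the density exceeds `1` by exactly `D` times the proportion of uncovered
`t`-sets (`density_greedyCovering`), and this proportion has to be bounded in expectation. The
`k`-sets are regarded as the edges of a `(D + 1)`-uniform hypergraph on the `t`-sets, and the greedy
selection as a greedy matching that examines the edges in a random order.

*Sampling with replacement.* Examining independent uniformly random edges gives a Markov chain on
the sets of unmatched vertices, with transition operator `transition`. Both in this chain and in the
random ordering, the next edge that is used is uniformly distributed among the edges all of whose
vertices are unmatched. Hence the expected final number of unmatched vertices is the same for both
(`finalMean`, `sum_finalMean_examine_succ`), and it is at most the expected number of unmatched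
vertices of the chain at any time `n` (`expect_card_examine_le`).

*The recursion.* By symmetry all vertices have the same probability `u m` of being unmatched after
`m` samples. A vertex gets matched when an edge containing it is drawn all of whose `D + 1` vertices
are unmatched. If these vertices were independently unmatched, then
`u (m + 1) = u m - y * u m ^ (D + 1)`, where `y` is the probability that a random edge contains a
given vertex, and `u n` would be of order `(n * y) ^ (-1 / D)` (`pow_succ_le_or_pow_mul_le`).

*Decay of correlations.* Deleting a vertex from the set of unmatched vertices influences other
vertices at later times only along edges that are drawn, so that `m` steps multiply the total
influence by at most `(1 + D * y) ^ m` (`HasInfluence.transition`, `IsSparse.sum_spread_iterate`).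
Two given vertices are in a common random edge with probability only `O(y / v)`, so the influences
of two vertices overlap little (`IsSparse.sum_spread_iterate_mul_le`). The covariance of two
functions at time `n` is a sum over the steps of the chain, each contributing at most the overlap of
the influences at that step (`IsSparse.transition_iterate_mul_ge`). Altogether the correlations are
of order `exp ((2 * D + 2) * n * y) / v`, which is a negative power of `v` as long as `n * y` is at
most a small multiple of `log v`. Taking `n * y` of order `log v` gives the theorem.
-/

namespace RandomGreedy

section Hypergraph

variable {α β : Type*} [DecidableEq α]

/-! ### The greedy step and its sensitivity to a single vertex -/

/-- The set of unmatched vertices after the edge `e` has been examined: its vertices are matched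
by `e` if they were all unmatched, and nothing changes otherwise. -/
def step (E : β → Finset α) (W : Finset α) (e : β) : Finset α :=
  if E e ⊆ W then W \ E e else W

/-- The weights `a` bound the influence of the vertices on `f`: making the vertex `w` matched
changes the value of `f` by at most `a w`. -/
def HasInfluence (f : Finset α → ℝ) (a : α → ℝ) : Prop :=
  ∀ W w, |f (W.erase w) - f W| ≤ a w

variable {E : β → Finset α} {f g : Finset α → ℝ} {a b : α → ℝ} {D : ℕ} {y η : ℝ}

theorem step_subset (W : Finset α) (e : β) : step E W e ⊆ W := by
  unfold step
  split_ifs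
  · exact sdiff_subset
  · exact subset_rfl

theorem step_map (π : Equiv.Perm α) (ρ : Equiv.Perm β)
    (hρ : ∀ e, E (ρ e) = (E e).map π.toEmbedding) (W : Finset α) (e : β) :
    step E (W.map π.toEmbedding) (ρ e) = (step E W e).map π.toEmbedding := by
  simp only [step, hρ, map_subset_map]
  split_ifs
  · ext x
    simp
  · rfl

theorem HasInfluence.nonneg (h : HasInfluence f a) (w : α) : 0 ≤ a w :=
  (abs_nonneg _).trans (h ∅ w)

theorem HasInfluence.abs_sdiff_sub_le (h : HasInfluence f a) (W S : Finset α) :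
    |f (W \ S) - f W| ≤ ∑ w ∈ S, a w := by
  induction S using Finset.induction_on with
  | empty => simp
  | insert w S hw ih =>
    rw [sum_insert hw, sdiff_insert]
    calc |f ((W \ S).erase w) - f W|
        ≤ |f ((W \ S).erase w) - f (W \ S)| + |f (W \ S) - f W| := abs_sub_le _ _ _
      _ ≤ _ := add_le_add (h _ _) ih

theorem HasInfluence.abs_step_sub_le (h : HasInfluence f a) (W : Finset α) (e : β) :
    |f (step E W e) - f W| ≤ ∑ w ∈ E e, a w := by
  unfold step
  split_ifs
  · exact h.abs_sdiff_sub_le _ _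
  · simpa using sum_nonneg fun w _ => h.nonneg w

theorem HasInfluence.abs_step_erase_sub_le (h : HasInfluence f a) (W : Finset α) (w : α) (e : β) :
    |f (step E (W.erase w) e) - f (step E W e)| ≤
      a w + if w ∈ E e then ∑ w' ∈ (E e).erase w, a w' else 0 := by
  have hnn : 0 ≤ ∑ w' ∈ (E e).erase w, a w' := sum_nonneg fun w _ => h.nonneg w
  by_cases hwW : w ∈ W
  swap
  · rw [erase_eq_of_notMem hwW, sub_self, abs_zero]
    have := h.nonneg w
    split_ifs <;> linarith
  by_cases hwe : w ∈ E e
  · rw [if_pos hwe]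
    have h1 : ¬ E e ⊆ W.erase w := fun hs => notMem_erase w W (hs hwe)
    unfold step
    rw [if_neg h1]
    split_ifs with h2
    · -- the edge is accepted only if `w` is still unmatched
      have h3 : W \ E e = W.erase w \ (E e).erase w := by
        ext x
        simp only [mem_sdiff, mem_erase]
        by_cases hx : x = w
        · subst hx; simp [hwe]
        · simp [hx]
      rw [h3, abs_sub_comm]
      linarith [h.abs_sdiff_sub_le (W.erase w) ((E e).erase w), h.nonneg w]
    · linarith [h W w]
  · rw [if_neg hwe, add_zero]
    have h1 : E e ⊆ W.erase w ↔ E e ⊆ W := by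
      rw [subset_erase]
      exact and_iff_left hwe
    unfold step
    simp only [h1]
    split_ifs
    · rw [erase_sdiff_comm]
      exact h _ _
    · exact h _ _

/-! ### Sampling edges with replacement -/

variable [Fintype β]

/-- The transition operator of the Markov chain on sets of unmatched vertices that examines a
uniformly random edge, drawn with replacement, at each time. -/
noncomputable def transition (E : β → Finset α) (f : Finset α → ℝ) (W : Finset α) : ℝ :=
  𝔼 e, f (step E W e)

theorem transition_mono (h : ∀ W, f W ≤ g W) (W : Finset α) :
    transition E f W ≤ transition E g W :=
  expect_le_expect fun _ _ => h _

theorem transition_iterate_mono (h : ∀ W, f W ≤ g W) (m : ℕ) :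
    ∀ W, (transition E)^[m] f W ≤ (transition E)^[m] g W := by
  induction m with
  | zero => exact h
  | succ m ih =>
    intro W
    rw [Function.iterate_succ_apply', Function.iterate_succ_apply']
    exact transition_mono ih W

theorem transition_iterate_nonneg (h : ∀ W, 0 ≤ f W) (m : ℕ) :
    ∀ W, 0 ≤ (transition E)^[m] f W := by
  induction m with
  | zero => exact h
  | succ m ih =>
    intro W
    rw [Function.iterate_succ_apply']
    exact expect_nonneg fun _ _ => ih _

theorem transition_iterate_sub (f g : Finset α → ℝ) (m : ℕ) :
    (transition E)^[m] (fun W => f W - g W) =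
      fun W => (transition E)^[m] f W - (transition E)^[m] g W := by
  induction m with
  | zero => rfl
  | succ m ih =>
    funext W
    simp only [Function.iterate_succ_apply', ih]
    exact expect_sub_distrib _ _ _

theorem transition_iterate_sum {ι : Type*} (s : Finset ι) (F : ι → Finset α → ℝ) (m : ℕ) :
    (transition E)^[m] (fun W => ∑ i ∈ s, F i W) =
      fun W => ∑ i ∈ s, (transition E)^[m] (F i) W := by
  induction m with
  | zero => rfl
  | succ m ih =>
    funext W
    simp only [Function.iterate_succ_apply', ih]
    exact expect_sum_comm _ _ _

theorem transition_iterate_expect {ι : Type*} (s : Finset ι) (F : ι → Finset α → ℝ) (m : ℕ) :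
    (transition E)^[m] (fun W => 𝔼 i ∈ s, F i W) =
      fun W => 𝔼 i ∈ s, (transition E)^[m] (F i) W := by
  induction m with
  | zero => rfl
  | succ m ih =>
    funext W
    simp only [Function.iterate_succ_apply', ih]
    exact expect_comm _ _ _

/-- The probability that a uniformly random edge contains both `w` and `w'`. -/
noncomputable def pairProb (E : β → Finset α) (w w' : α) : ℝ :=
  𝔼 e, if w ∈ E e ∧ w' ∈ E e then (1 : ℝ) else 0

/-- The family `E` is `(D + 1)`-uniform, a random edge contains any given vertex with probability
`y`, and contains any two given vertices with probability at most `η`. -/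
structure IsSparse (E : β → Finset α) (D : ℕ) (y η : ℝ) : Prop where
  card_eq : ∀ e, (E e).card = D + 1
  pairProb_self : ∀ w, pairProb E w w = y
  pairProb_le : ∀ w w', w ≠ w' → pairProb E w w' ≤ η

theorem pairProb_nonneg (w w' : α) : 0 ≤ pairProb E w w' :=
  expect_nonneg fun _ _ => by split_ifs <;> norm_num

theorem pairProb_comm (w w' : α) : pairProb E w w' = pairProb E w' w := by
  simp only [pairProb, and_comm]

/-! ### The spread of influences -/

variable [Fintype α]

/-- How influences spread when the chain is run for one more step, see `HasInfluence.transition`. -/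
noncomputable def spread (E : β → Finset α) (a : α → ℝ) (w : α) : ℝ :=
  a w + ∑ w' ∈ univ.erase w, pairProb E w w' * a w'

theorem IsSparse.sum_pairProb (h : IsSparse E D y η) (w : α) :
    ∑ w' ∈ univ.erase w, pairProb E w w' = D * y := by
  have key : ∑ w', pairProb E w w' = (D + 1) * y := by
    rw [← h.pairProb_self w]
    unfold pairProb
    rw [← expect_sum_comm, mul_expect]
    refine expect_congr rfl fun e _ => ?_
    by_cases hw : w ∈ E e
    · simp [hw, h.card_eq e]
    · simp [hw]
  rw [← add_sum_erase _ _ (mem_univ w), h.pairProb_self] at key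
  linarith

theorem expect_ite_sum_erase (w : α) :
    (𝔼 e, if w ∈ E e then ∑ w' ∈ (E e).erase w, a w' else 0) =
      ∑ w' ∈ univ.erase w, pairProb E w w' * a w' := by
  unfold pairProb
  simp only [expect_mul]
  rw [← expect_sum_comm]
  refine expect_congr rfl fun e _ => ?_
  by_cases hw : w ∈ E e
  · simp only [hw, if_true, true_and, ite_mul, one_mul, zero_mul, ← sum_filter]
    refine sum_congr ?_ fun _ _ => rfl
    ext x
    simp [and_comm]
  · simp [hw]

/-- Running the chain for one more step makes the influences spread along the edges. -/
theorem HasInfluence.transition [Nonempty β] (h : HasInfluence f a) :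
    HasInfluence (transition E f) (spread E a) := by
  intro W w
  unfold RandomGreedy.transition
  rw [← expect_sub_distrib]
  refine (abs_expect_le _ _).trans ((expect_le_expect fun e _ =>
    h.abs_step_erase_sub_le W w e).trans_eq ?_)
  rw [expect_add_distrib, expect_const univ_nonempty, expect_ite_sum_erase]
  rfl

theorem HasInfluence.transition_iterate [Nonempty β] (h : HasInfluence f a) (m : ℕ) :
    HasInfluence ((RandomGreedy.transition E)^[m] f) ((spread E)^[m] a) := by
  induction m with
  | zero => exact h
  | succ m ih =>
    rw [Function.iterate_succ_apply', Function.iterate_succ_apply']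
    exact ih.transition

theorem spread_nonneg (ha : ∀ w, 0 ≤ a w) (w : α) : 0 ≤ spread E a w :=
  add_nonneg (ha w) (sum_nonneg fun w' _ => mul_nonneg (pairProb_nonneg w w') (ha w'))

theorem spread_iterate_nonneg (ha : ∀ w, 0 ≤ a w) (m : ℕ) : ∀ w, 0 ≤ (spread E)^[m] a w := by
  induction m with
  | zero => exact ha
  | succ m ih =>
    rw [Function.iterate_succ_apply']
    exact spread_nonneg ih

theorem IsSparse.sum_sum_pairProb_mul (h : IsSparse E D y η) (a : α → ℝ) :
    ∑ w, ∑ w' ∈ univ.erase w, pairProb E w w' * a w' = D * y * ∑ w, a w := by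
  have hcomm : ∑ w, ∑ w' ∈ univ.erase w, pairProb E w w' * a w' =
      ∑ w', ∑ w ∈ univ.erase w', pairProb E w w' * a w' :=
    sum_comm' fun w w' => by simp [eq_comm]
  rw [hcomm, mul_sum]
  refine sum_congr rfl fun w' _ => ?_
  rw [← sum_mul, ← h.sum_pairProb w']
  simp only [pairProb_comm]

theorem IsSparse.sum_spread (h : IsSparse E D y η) (a : α → ℝ) :
    ∑ w, spread E a w = (1 + D * y) * ∑ w, a w := by
  unfold spread
  rw [sum_add_distrib, h.sum_sum_pairProb_mul]
  ring

theorem IsSparse.sum_spread_iterate (h : IsSparse E D y η) (a : α → ℝ) (m : ℕ) :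
    ∑ w, (spread E)^[m] a w = (1 + D * y) ^ m * ∑ w, a w := by
  induction m with
  | zero => simp
  | succ m ih => rw [Function.iterate_succ_apply', h.sum_spread, ih]; ring

theorem IsSparse.sum_pairProb_mul_le (h : IsSparse E D y η) (hη : 0 ≤ η) (ha : ∀ w, 0 ≤ a w)
    (w : α) : ∑ w' ∈ univ.erase w, pairProb E w w' * a w' ≤ η * ∑ w, a w := by
  rw [mul_sum]
  calc ∑ w' ∈ univ.erase w, pairProb E w w' * a w'
      ≤ ∑ w' ∈ univ.erase w, η * a w' := sum_le_sum fun w' hw' =>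
        mul_le_mul_of_nonneg_right (h.pairProb_le _ _ (ne_of_mem_erase hw').symm) (ha w')
    _ ≤ ∑ w', η * a w' := sum_le_sum_of_subset_of_nonneg (erase_subset _ _)
        fun w' _ _ => mul_nonneg hη (ha w')

/-- Influences that have no vertex in common overlap only little after they have spread: two
given vertices are hardly ever in a common edge. -/
theorem IsSparse.sum_spread_mul_spread_le (h : IsSparse E D y η) (hη : 0 ≤ η)
    (ha : ∀ w, 0 ≤ a w) (hb : ∀ w, 0 ≤ b w) :
    ∑ w, spread E a w * spread E b w ≤
      ∑ w, a w * b w + η * (2 + D * y) * ((∑ w, a w) * ∑ w, b w) := by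
  set A := fun w => ∑ w' ∈ univ.erase w, pairProb E w w' * a w' with hA
  set B := fun w => ∑ w' ∈ univ.erase w, pairProb E w w' * b w' with hB
  have hA0 : ∀ w, 0 ≤ A w := fun w =>
    sum_nonneg fun w' _ => mul_nonneg (pairProb_nonneg w w') (ha w')
  have hAle : ∀ w, A w ≤ η * ∑ w, a w := h.sum_pairProb_mul_le hη ha
  have hBle : ∀ w, B w ≤ η * ∑ w, b w := h.sum_pairProb_mul_le hη hb
  have hAsum : ∑ w, A w = D * y * ∑ w, a w := h.sum_sum_pairProb_mul a
  calc ∑ w, spread E a w * spread E b w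
      = ∑ w, (a w * b w + a w * B w + b w * A w + A w * B w) :=
        sum_congr rfl fun w _ => by simp only [spread, hA, hB]; ring
    _ ≤ ∑ w, (a w * b w + a w * (η * ∑ w, b w) + b w * (η * ∑ w, a w) +
          A w * (η * ∑ w, b w)) := by
        refine sum_le_sum fun w _ => ?_
        have h1 := mul_le_mul_of_nonneg_left (hBle w) (ha w)
        have h2 := mul_le_mul_of_nonneg_left (hAle w) (hb w)
        have h3 := mul_le_mul_of_nonneg_left (hBle w) (hA0 w)
        linarith
    _ = _ := by
        simp only [sum_add_distrib, ← sum_mul, hAsum]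
        ring

/-- The overlap of two influences without a common vertex after `m ≤ n` steps. -/
theorem IsSparse.sum_spread_iterate_mul_le (h : IsSparse E D y η) (hη : 0 ≤ η) (hy : 0 ≤ y)
    (ha : ∀ w, 0 ≤ a w) (hb : ∀ w, 0 ≤ b w) (hab : ∑ w, a w * b w = 0) (m : ℕ) :
    ∑ w, (spread E)^[m] a w * (spread E)^[m] b w ≤
      m * (η * (2 + D * y) * (((1 + D * y) ^ m) ^ 2 * ((∑ w, a w) * ∑ w, b w))) := by
  induction m with
  | zero => simp [hab]
  | succ m ih =>
    simp only [Function.iterate_succ_apply']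
    refine (h.sum_spread_mul_spread_le hη (spread_iterate_nonneg ha m)
      (spread_iterate_nonneg hb m)).trans ?_
    rw [h.sum_spread_iterate, h.sum_spread_iterate]
    have hDy : 0 ≤ D * y := by positivity
    have hA : 0 ≤ ∑ w, a w := sum_nonneg fun w _ => ha w
    have hB : 0 ≤ ∑ w, b w := sum_nonneg fun w _ => hb w
    have hpow : ((1 + D * y) ^ m) ^ 2 ≤ ((1 + D * y) ^ (m + 1)) ^ 2 := by
      gcongr
      · linarith
      · exact Nat.le_succ m
    have hmul : η * (2 + D * y) * (((1 + D * y) ^ m) ^ 2 * ((∑ w, a w) * ∑ w, b w)) ≤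
        η * (2 + D * y) * (((1 + D * y) ^ (m + 1)) ^ 2 * ((∑ w, a w) * ∑ w, b w)) := by
      gcongr
    have hm : (0 : ℝ) ≤ m := Nat.cast_nonneg m
    push_cast
    nlinarith [mul_le_mul_of_nonneg_left hmul hm]

/-! ### Correlations -/

theorem IsSparse.expect_sum (h : IsSparse E D y η) (a : α → ℝ) :
    (𝔼 e, ∑ w ∈ E e, a w) = y * ∑ w, a w := by
  have h1 : ∀ e, ∑ w ∈ E e, a w = ∑ w, (if w ∈ E e ∧ w ∈ E e then 1 else 0) * a w := by
    intro e
    simp [ite_mul]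
  simp only [h1]
  rw [expect_sum_comm, mul_sum]
  refine sum_congr rfl fun w _ => ?_
  rw [← expect_mul, ← h.pairProb_self w]
  rfl

theorem expect_sum_mul_sum :
    (𝔼 e, (∑ w ∈ E e, a w) * ∑ w ∈ E e, b w) = ∑ w, ∑ w', pairProb E w w' * (a w * b w') := by
  have h1 : ∀ e, (∑ w ∈ E e, a w) * ∑ w ∈ E e, b w =
      ∑ w, ∑ w', (if w ∈ E e ∧ w' ∈ E e then 1 else 0) * (a w * b w') := by
    intro e
    simp [ite_and, sum_mul_sum]
  simp only [h1]
  rw [expect_sum_comm]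
  refine sum_congr rfl fun w _ => ?_
  rw [expect_sum_comm]
  refine sum_congr rfl fun w' _ => ?_
  rw [← expect_mul]
  rfl

theorem IsSparse.expect_sum_mul_sum_le (h : IsSparse E D y η) (hη : 0 ≤ η)
    (ha : ∀ w, 0 ≤ a w) (hb : ∀ w, 0 ≤ b w) :
    (𝔼 e, (∑ w ∈ E e, a w) * ∑ w ∈ E e, b w) ≤
      y * ∑ w, a w * b w + η * ((∑ w, a w) * ∑ w, b w) := by
  rw [expect_sum_mul_sum]
  calc ∑ w, ∑ w', pairProb E w w' * (a w * b w')
      = ∑ w, (y * (a w * b w) + a w * ∑ w' ∈ univ.erase w, pairProb E w w' * b w') := by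
        refine sum_congr rfl fun w _ => ?_
        rw [← add_sum_erase _ _ (mem_univ w), h.pairProb_self, mul_sum]
        congr 1
        exact sum_congr rfl fun w' _ => by ring
    _ ≤ ∑ w, (y * (a w * b w) + a w * (η * ∑ w, b w)) := by
        gcongr with w
        · exact ha w
        · exact h.sum_pairProb_mul_le hη hb w
    _ = _ := by
        rw [sum_add_distrib, ← mul_sum, ← sum_mul]
        ring

/-- The covariance of `f` and `g` in one step of the chain. -/
theorem IsSparse.transition_mul_ge [Nonempty β] (h : IsSparse E D y η) (hη : 0 ≤ η)
    (hf : HasInfluence f a) (hg : HasInfluence g b) (W : Finset α) :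
    transition E f W * transition E g W -
        (y * ∑ w, a w * b w + (η + y ^ 2) * ((∑ w, a w) * ∑ w, b w)) ≤
      transition E (fun W => f W * g W) W := by
  set F := fun e => f (step E W e) - f W with hF
  set G := fun e => g (step E W e) - g W with hG
  have hFG : -(𝔼 e, (∑ w ∈ E e, a w) * ∑ w ∈ E e, b w) ≤ 𝔼 e, F e * G e := by
    refine neg_le_of_abs_le ((abs_expect_le _ _).trans (expect_le_expect fun e _ => ?_))
    rw [abs_mul]
    exact mul_le_mul (hf.abs_step_sub_le W e) (hg.abs_step_sub_le W e) (abs_nonneg _)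
      (sum_nonneg fun w _ => hf.nonneg w)
  have hFe : |𝔼 e, F e| ≤ y * ∑ w, a w := by
    rw [← h.expect_sum]
    exact (abs_expect_le _ _).trans (expect_le_expect fun e _ => hf.abs_step_sub_le W e)
  have hGe : |𝔼 e, G e| ≤ y * ∑ w, b w := by
    rw [← h.expect_sum]
    exact (abs_expect_le _ _).trans (expect_le_expect fun e _ => hg.abs_step_sub_le W e)
  have hprod : (𝔼 e, F e) * (𝔼 e, G e) ≤ (y * ∑ w, a w) * (y * ∑ w, b w) := by
    refine (le_abs_self _).trans ?_
    rw [abs_mul]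
    exact mul_le_mul hFe hGe (abs_nonneg _) ((abs_nonneg _).trans hFe)
  have hle := h.expect_sum_mul_sum_le hη hf.nonneg hg.nonneg
  have e1 : transition E f W = f W + 𝔼 e, F e := by
    simp only [hF, expect_sub_distrib, expect_const univ_nonempty, transition]
    ring
  have e2 : transition E g W = g W + 𝔼 e, G e := by
    simp only [hG, expect_sub_distrib, expect_const univ_nonempty, transition]
    ring
  have e3 : transition E (fun W => f W * g W) W =
      f W * g W + g W * (𝔼 e, F e) + f W * (𝔼 e, G e) + 𝔼 e, F e * G e := by
    rw [mul_expect, mul_expect, ← expect_const (univ_nonempty (α := β)) (f W * g W),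
      ← expect_add_distrib, ← expect_add_distrib, ← expect_add_distrib]
    refine expect_congr rfl fun e _ => ?_
    simp only [hF, hG]
    ring
  rw [e1, e2, e3]
  nlinarith

/-- Functions that are influenced by disjoint sets of vertices are almost uncorrelated along the
chain. -/
theorem IsSparse.transition_iterate_mul_ge [Nonempty β] (h : IsSparse E D y η) (hη : 0 ≤ η)
    (hy : 0 ≤ y) (hf : HasInfluence f a) (hg : HasInfluence g b) (hab : ∑ w, a w * b w = 0)
    (n : ℕ) (W : Finset α) :
    (transition E)^[n] f W * (transition E)^[n] g W -
        n * ((y * (n * (η * (2 + D * y))) + (η + y ^ 2)) *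
          (((1 + D * y) ^ n) ^ 2 * ((∑ w, a w) * ∑ w, b w))) ≤
      (transition E)^[n] (fun W => f W * g W) W := by
  have hDy : 0 ≤ D * y := by positivity
  have hA : 0 ≤ ∑ w, a w := sum_nonneg fun w _ => hf.nonneg w
  have hB : 0 ≤ ∑ w, b w := sum_nonneg fun w _ => hg.nonneg w
  set err := (y * (n * (η * (2 + D * y))) + (η + y ^ 2)) *
          (((1 + D * y) ^ n) ^ 2 * ((∑ w, a w) * ∑ w, b w)) with herr
  suffices key : ∀ m ≤ n, ∀ W, (transition E)^[m] f W * (transition E)^[m] g W - m * err ≤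
      (transition E)^[m] (fun W => f W * g W) W from key n le_rfl W
  intro m
  induction m with
  | zero => intro _ W; simp
  | succ m ih =>
    intro hm W
    have ih' := ih (Nat.le_of_succ_le hm)
    have hmn : (m : ℝ) ≤ n := by exact_mod_cast Nat.le_of_succ_le hm
    have h1 := h.transition_mul_ge hη (hf.transition_iterate (E := E) m)
      (hg.transition_iterate (E := E) m) W
    have h2 : y * ∑ w, (spread E)^[m] a w * (spread E)^[m] b w +
        (η + y ^ 2) * ((∑ w, (spread E)^[m] a w) * ∑ w, (spread E)^[m] b w) ≤ err := by
      rw [h.sum_spread_iterate, h.sum_spread_iterate, herr]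
      have h3 := mul_le_mul_of_nonneg_left
        (h.sum_spread_iterate_mul_le hη hy hf.nonneg hg.nonneg hab m) hy
      have hpow : ((1 + D * y) ^ m) ^ 2 ≤ ((1 + D * y) ^ n) ^ 2 := by
        gcongr
        · linarith
        · exact Nat.le_of_succ_le hm
      calc _ ≤ (y * (m * (η * (2 + D * y))) + (η + y ^ 2)) *
          (((1 + D * y) ^ m) ^ 2 * ((∑ w, a w) * ∑ w, b w)) := by linarith
        _ ≤ _ := by gcongr
    have h4 := transition_mono (E := E) ih' W
    have h5 : transition E (fun W => (transition E)^[m] f W * (transition E)^[m] g W - m * err) W =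
        transition E (fun W => (transition E)^[m] f W * (transition E)^[m] g W) W - m * err := by
      simp only [transition, expect_sub_distrib, expect_const univ_nonempty]
    rw [h5] at h4
    simp only [Function.iterate_succ_apply']
    push_cast
    linarith

end Hypergraph

section Survival

variable {α β : Type*} [DecidableEq α] [Fintype β] {E : β → Finset α} {D : ℕ} {y η : ℝ}

/-! ### The survival probability of a vertex -/

/-- The indicator function of the event that all vertices in `S` are unmatched. -/
noncomputable def allUnmatched (S W : Finset α) : ℝ := if S ⊆ W then 1 else 0

theorem allUnmatched_nonneg (S W : Finset α) : 0 ≤ allUnmatched S W := by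
  unfold allUnmatched
  split_ifs <;> norm_num

theorem allUnmatched_mono {S W W' : Finset α} (h : W ⊆ W') :
    allUnmatched S W ≤ allUnmatched S W' := by
  unfold allUnmatched
  split_ifs with h1 h2
  · exact le_rfl
  · exact absurd (h1.trans h) h2
  · norm_num
  · exact le_rfl

theorem hasInfluence_allUnmatched (S : Finset α) :
    HasInfluence (allUnmatched S) fun w => if w ∈ S then 1 else 0 := by
  intro W w
  unfold allUnmatched
  by_cases hw : w ∈ S
  · simp only [if_pos hw]
    split_ifs <;> norm_num
  · simp [subset_erase, hw]

theorem transition_allUnmatched_le [Nonempty β] (S W : Finset α) :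
    transition E (allUnmatched S) W ≤ allUnmatched S W :=
  expect_le univ_nonempty fun e _ => allUnmatched_mono (step_subset W e)

/-- A vertex gets matched when an edge containing it is examined all of whose vertices are
unmatched. -/
theorem transition_allUnmatched_singleton (T : α) :
    transition E (allUnmatched {T}) = fun W =>
      𝔼 e, (allUnmatched {T} W - if T ∈ E e then allUnmatched (E e) W else 0) := by
  funext W
  refine expect_congr rfl fun e _ => ?_
  unfold allUnmatched step
  by_cases hT : T ∈ E e
  · by_cases hW : E e ⊆ W
    · simp [hT, hW, hW hT]
    · simp [hT, hW]
  · by_cases hW : E e ⊆ W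
    · simp [hT, hW]
    · simp [hT, hW]

/-- The bound from `IsSparse.transition_iterate_mul_ge`, for functions of total influence `1`. -/
noncomputable def correlationError (D : ℕ) (y η : ℝ) (n : ℕ) : ℝ :=
  n * ((y * (n * (η * (2 + D * y))) + (η + y ^ 2)) * ((1 + D * y) ^ n) ^ 2)

theorem correlationError_nonneg (hη : 0 ≤ η) (hy : 0 ≤ y) (n : ℕ) :
    0 ≤ correlationError D y η n := by
  unfold correlationError
  positivity

theorem correlationError_mono (hη : 0 ≤ η) (hy : 0 ≤ y) {m n : ℕ} (hmn : m ≤ n) :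
    correlationError D y η m ≤ correlationError D y η n := by
  have hDy : 0 ≤ D * y := by positivity
  unfold correlationError
  gcongr
  linarith

/-- The recursion `u (m + 1) ≤ u m - y * u m ^ (D + 1)` forces `u n ^ D` to decay like
`1 / (n * y)`, as long as `u` is not so small that the error term `ε` matters. -/
theorem pow_succ_le_or_pow_mul_le {u : ℕ → ℝ} {ε : ℝ} {n : ℕ} (hD : 1 ≤ D) (hy : 0 ≤ y)
    (hu0 : ∀ m, 0 ≤ u m) (hu1 : u 0 ≤ 1) (hu : Antitone u)
    (hrec : ∀ m < n, u (m + 1) ≤ u m - y * (u m ^ (D + 1) - ε)) :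
    u n ^ (D + 1) ≤ 2 * ε ∨ u n ^ D * (n * y) ≤ 2 := by
  by_cases hlarge : u n ^ (D + 1) ≤ 2 * ε
  · exact Or.inl hlarge
  right
  push Not at hlarge
  suffices key : ∀ m ≤ n, u m ^ D * (1 + m * (y / 2)) ≤ 1 by
    have h1 := key n le_rfl
    have h2 := pow_nonneg (hu0 n) D
    linarith
  intro m
  induction m with
  | zero =>
    intro _
    simpa using pow_le_one₀ (hu0 0) hu1
  | succ m ih =>
    intro hm
    have hp := ih (Nat.le_of_succ_le hm)
    set p := u m ^ D with hpdef
    have hp0 : 0 ≤ p := pow_nonneg (hu0 m) D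
    have hε : 2 * ε ≤ u m ^ (D + 1) :=
      hlarge.le.trans (pow_le_pow_left₀ (hu0 n) (hu (Nat.le_of_succ_le hm)) _)
    have hstep : u (m + 1) ≤ u m * (1 - y / 2 * p) := by
      have h1 := hrec m hm
      have h2 := mul_le_mul_of_nonneg_left hε hy
      have h3 : u m ^ (D + 1) = p * u m := pow_succ _ _
      rw [h3] at h1 h2
      linarith
    rcases (hu0 m).eq_or_lt with hz | hpos
    · have h0 : u (m + 1) = 0 := le_antisymm (hz ▸ hu (Nat.le_succ m)) (hu0 _)
      rw [h0, zero_pow (by omega), zero_mul]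
      exact zero_le_one
    have hz0 : 0 ≤ 1 - y / 2 * p := nonneg_of_mul_nonneg_right ((hu0 _).trans hstep) hpos
    have hz1 : 0 ≤ y / 2 * p := by positivity
    have hpow : u (m + 1) ^ D ≤ p * (1 - y / 2 * p) :=
      calc u (m + 1) ^ D ≤ (u m * (1 - y / 2 * p)) ^ D := pow_le_pow_left₀ (hu0 _) hstep D
        _ = p * (1 - y / 2 * p) ^ D := mul_pow _ _ _
        _ ≤ p * (1 - y / 2 * p) :=
          mul_le_mul_of_nonneg_left (pow_le_of_le_one hz0 (by linarith) (by omega)) hp0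
    calc u (m + 1) ^ D * (1 + (m + 1 : ℕ) * (y / 2))
        ≤ p * (1 - y / 2 * p) * (1 + (m + 1 : ℕ) * (y / 2)) :=
          mul_le_mul_of_nonneg_right hpow (by positivity)
      _ = (1 - y / 2 * p) * (p * (1 + m * (y / 2)) + y / 2 * p) := by push_cast; ring
      _ ≤ (1 - y / 2 * p) * (1 + y / 2 * p) := by gcongr
      _ ≤ 1 := by nlinarith [mul_nonneg hz1 hz1]

theorem transition_iterate_map (π : Equiv.Perm α) (ρ : Equiv.Perm β)
    (hρ : ∀ e, E (ρ e) = (E e).map π.toEmbedding) (f : Finset α → ℝ) (m : ℕ) :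
    ∀ W, (transition E)^[m] f (W.map π.toEmbedding) =
      (transition E)^[m] (fun W => f (W.map π.toEmbedding)) W := by
  induction m with
  | zero => intro W; rfl
  | succ m ih =>
    intro W
    rw [Function.iterate_succ_apply', Function.iterate_succ_apply']
    refine (Fintype.expect_equiv ρ _ _ fun e => ?_).symm
    rw [← ih, step_map π ρ hρ]

variable [Fintype α]

/-- The vertices of a set are almost independently unmatched. -/
theorem IsSparse.pow_le_transition_iterate_allUnmatched [Nonempty β] (h : IsSparse E D y η)
    (hη : 0 ≤ η) (hy : 0 ≤ y) {m : ℕ} {u : ℝ} (W : Finset α) (hu0 : 0 ≤ u) (hu1 : u ≤ 1)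
    (hu : ∀ T, (transition E)^[m] (allUnmatched {T}) W = u) (S : Finset α) (hS : S.Nonempty) :
    u ^ #S - #S ^ 2 * correlationError D y η m ≤ (transition E)^[m] (allUnmatched S) W := by
  have he := correlationError_nonneg (D := D) hη hy m
  induction hS using Finset.Nonempty.cons_induction with
  | singleton T =>
    rw [hu, card_singleton]
    norm_num
    exact he
  | cons T S hT hS ih =>
    have hprod : allUnmatched (cons T S hT) = fun W => allUnmatched {T} W * allUnmatched S W := by
      funext W
      unfold allUnmatched
      simp only [cons_eq_insert, insert_subset_iff, singleton_subset_iff, ite_zero_mul_ite_zero,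
        one_mul]
    have hge := h.transition_iterate_mul_ge hη hy (hasInfluence_allUnmatched {T})
      (hasInfluence_allUnmatched S) (by simp [hT]) m W
    have herr : m * ((y * (m * (η * (2 + D * y))) + (η + y ^ 2)) * (((1 + D * y) ^ m) ^ 2 *
        ((∑ w, if w ∈ ({T} : Finset α) then (1 : ℝ) else 0) * ∑ w, if w ∈ S then (1 : ℝ) else 0))) =
        #S * correlationError D y η m := by
      have h1 : (∑ w, if w ∈ ({T} : Finset α) then (1 : ℝ) else 0) = 1 := by simp
      have h2 : (∑ w, if w ∈ S then (1 : ℝ) else 0) = #S := by simp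
      rw [h1, h2, correlationError]
      ring
    rw [herr, hu, ← hprod] at hge
    rw [card_cons]
    push_cast
    have hs : (0 : ℝ) ≤ #S := Nat.cast_nonneg _
    have h3 := mul_le_mul_of_nonneg_left ih hu0
    have h4 : u * (#S ^ 2 * correlationError D y η m) ≤ #S ^ 2 * correlationError D y η m :=
      mul_le_of_le_one_left (by positivity) hu1
    rw [pow_succ]
    nlinarith [mul_nonneg hs he]

/-- The decrease of the survival probability in one step. -/
theorem IsSparse.transition_iterate_succ_le [Nonempty β] (h : IsSparse E D y η)
    (hη : 0 ≤ η) (hy : 0 ≤ y) {m : ℕ} {u : ℝ} (W : Finset α) (hu0 : 0 ≤ u) (hu1 : u ≤ 1)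
    (hu : ∀ T, (transition E)^[m] (allUnmatched {T}) W = u) (T : α) :
    (transition E)^[m + 1] (allUnmatched {T}) W ≤
      u - y * (u ^ (D + 1) - (D + 1) ^ 2 * correlationError D y η m) := by
  have hloss : ∀ e, u - (if T ∈ E e ∧ T ∈ E e then 1 else 0) *
      (u ^ (D + 1) - (D + 1) ^ 2 * correlationError D y η m) ≥
      (transition E)^[m] (fun W => allUnmatched {T} W -
        if T ∈ E e then allUnmatched (E e) W else 0) W := by
    intro e
    by_cases hT : T ∈ E e
    · have h1 := h.pow_le_transition_iterate_allUnmatched hη hy W hu0 hu1 hu (E e) ⟨T, hT⟩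
      rw [h.card_eq e] at h1
      push_cast at h1
      simp only [hT, and_self, if_true, transition_iterate_sub, hu, one_mul]
      linarith
    · simp [hT, hu]
  rw [Function.iterate_succ_apply, transition_allUnmatched_singleton, transition_iterate_expect]
  refine (expect_le_expect fun e _ => hloss e).trans_eq ?_
  rw [expect_sub_distrib, expect_const univ_nonempty, ← expect_mul, ← h.pairProb_self T]
  rfl

/-- If the symmetries of the family of edges permute the vertices transitively, then all vertices
have the same survival probability, and it obeys the bound from `pow_succ_le_or_pow_mul_le`. -/
theorem IsSparse.survival_le [Nonempty β] (h : IsSparse E D y η) (hD : 1 ≤ D)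
    (hη : 0 ≤ η) (hy : 0 ≤ y)
    (htrans : ∀ T T', ∃ π : Equiv.Perm α, ∃ ρ : Equiv.Perm β, π T = T' ∧
      ∀ e, E (ρ e) = (E e).map π.toEmbedding) (T : α) (n : ℕ) :
    ∃ u : ℝ, (∀ T, (transition E)^[n] (allUnmatched {T}) univ = u) ∧ 0 ≤ u ∧ u ≤ 1 ∧
      (u ^ (D + 1) ≤ 2 * ((D + 1) ^ 2 * correlationError D y η n) ∨ u ^ D * (n * y) ≤ 2) := by
  set u := fun m => (transition E)^[m] (allUnmatched {T}) univ with hudef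
  have hsymm : ∀ m T', (transition E)^[m] (allUnmatched {T'}) univ = u m := by
    intro m T'
    obtain ⟨π, ρ, rfl, hρ⟩ := htrans T T'
    have h1 := transition_iterate_map π ρ hρ (allUnmatched {π T}) m univ
    rw [map_univ_equiv] at h1
    have h2 : (fun W => allUnmatched {π T} (W.map π.toEmbedding)) = allUnmatched {T} := by
      funext W
      simp [allUnmatched]
    rw [h1, h2]
  have hu0 : ∀ m, 0 ≤ u m := fun m => transition_iterate_nonneg (allUnmatched_nonneg _) m _
  have hanti : Antitone u := antitone_nat_of_succ_le fun m => by
    simp only [hudef, Function.iterate_succ_apply]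
    exact transition_iterate_mono (transition_allUnmatched_le _) m _
  have hone : u 0 = 1 := by simp [hudef, allUnmatched]
  have hu1 : ∀ m, u m ≤ 1 := fun m => (hanti (Nat.zero_le m)).trans_eq hone
  refine ⟨u n, hsymm n, hu0 n, hu1 n, ?_⟩
  refine pow_succ_le_or_pow_mul_le hD hy hu0 hone.le hanti fun m hm => ?_
  refine (h.transition_iterate_succ_le hη hy univ (hu0 m) (hu1 m) (hsymm m) T).trans ?_
  gcongr
  exact correlationError_mono hη hy hm.le

end Survival

section Examine

variable {α β : Type*} [DecidableEq α] {E : β → Finset α}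

/-! ### Examining the edges in a given order -/

section Order

variable [Fintype α] {n : ℕ}

/-- The set of unmatched vertices after the first `m` edges in the ordering `σ` have been
examined. -/
def examine (E : β → Finset α) (σ : β ≃ Fin n) : ℕ → Finset α
  | 0 => univ
  | m + 1 => if h : m < n then step E (examine E σ m) (σ.symm ⟨m, h⟩) else examine E σ m

theorem examine_succ (σ : β ≃ Fin n) {m : ℕ} (h : m < n) :
    examine E σ (m + 1) = step E (examine E σ m) (σ.symm ⟨m, h⟩) :=
  dif_pos h

theorem examine_swap (σ : β ≃ Fin n) {i j : Fin n} {m : ℕ} (hi : m ≤ i) (hj : m ≤ j) :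
    examine E (σ.trans (Equiv.swap i j)) m = examine E σ m := by
  induction m with
  | zero => rfl
  | succ m ih =>
    have hm : m < n := hi.trans i.2.le
    rw [examine_succ _ hm, examine_succ _ hm, ih (by omega) (by omega)]
    congr 1
    rw [Equiv.symm_trans_apply, Equiv.symm_swap, Equiv.swap_apply_of_ne_of_ne]
    · exact Fin.ne_of_val_ne (by simp; omega)
    · exact Fin.ne_of_val_ne (by simp; omega)

theorem not_subset_examine (hE : ∀ e, (E e).Nonempty) (σ : β ≃ Fin n) {m : ℕ} {e : β}
    (he : σ e < m) : ¬ E e ⊆ examine E σ m := by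
  induction m with
  | zero => exact absurd he (Nat.not_lt_zero _)
  | succ m ih =>
    by_cases hm : m < n
    swap
    · have := (σ e).2
      rw [examine, dif_neg hm]
      exact ih (by omega)
    rw [examine_succ σ hm]
    rcases (Nat.lt_succ_iff.1 he).lt_or_eq with hlt | heq
    · exact fun h => ih hlt (h.trans (step_subset _ _))
    · have h1 : σ.symm ⟨m, hm⟩ = e := by
        rw [Equiv.symm_apply_eq]
        exact Fin.ext heq.symm
      rw [h1, step]
      split_ifs with h2
      · intro h3
        obtain ⟨x, hx⟩ := hE e
        exact (mem_sdiff.1 (h3 hx)).2 hx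
      · exact h2

end Order

/-! ### The expected number of vertices left unmatched in the end -/

variable [Fintype β]

/-- The expected final number of unmatched vertices, if random edges are examined from the set `W`
of unmatched vertices on: the next edge that is used is uniformly distributed among the edges all
of whose vertices are unmatched. -/
noncomputable def finalMean (E : β → Finset α) (hE : ∀ e, (E e).Nonempty) (W : Finset α) : ℝ :=
  if ∃ e, E e ⊆ W then
    (#{e | E e ⊆ W} : ℝ)⁻¹ * ∑ e : {e // E e ⊆ W}, finalMean E hE (W \ E e)
  else #W
termination_by #W
decreasing_by
  exact card_lt_card (sdiff_ssubset e.2 (hE e))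

theorem finalMean_of_forall_not_subset (hE : ∀ e, (E e).Nonempty) {W : Finset α}
    (h : ∀ e, ¬ E e ⊆ W) : finalMean E hE W = #W := by
  rw [finalMean, if_neg (by simpa using h)]

theorem sum_finalMean_sdiff_sub (hE : ∀ e, (E e).Nonempty) (W : Finset α) :
    ∑ e with E e ⊆ W, (finalMean E hE (W \ E e) - finalMean E hE W) = 0 := by
  by_cases h : ∃ e, E e ⊆ W
  · have hcard : (#{e | E e ⊆ W} : ℝ) ≠ 0 := by
      obtain ⟨e, he⟩ := h
      exact_mod_cast (card_pos.2 ⟨e, by simpa using he⟩).ne'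
    have hW : finalMean E hE W =
        (#{e | E e ⊆ W} : ℝ)⁻¹ * ∑ e with E e ⊆ W, finalMean E hE (W \ E e) := by
      rw [finalMean, if_pos h, ← sum_subtype_eq_sum_filter, subtype_univ]
    rw [sum_sub_distrib, sum_const, nsmul_eq_mul, hW, mul_inv_cancel_left₀ hcard, sub_self]
  · rw [filter_eq_empty_iff.2 fun e _ he => h ⟨e, he⟩, sum_empty]

/-- `finalMean` is harmonic: its value does not change on average when a random edge is examined,
whether or not the edge can be used. -/
theorem sum_finalMean_step_sub (hE : ∀ e, (E e).Nonempty) (W : Finset α) :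
    ∑ e, (finalMean E hE (step E W e) - finalMean E hE W) = 0 := by
  rw [← sum_finalMean_sdiff_sub hE W, sum_filter]
  refine sum_congr rfl fun e _ => ?_
  unfold step
  split_ifs <;> simp

theorem finalMean_le_card (hE : ∀ e, (E e).Nonempty) (W : Finset α) :
    finalMean E hE W ≤ #W := by
  induction W using Finset.strongInduction with
  | H W ih =>
    by_cases h : ∃ e, E e ⊆ W
    · rw [finalMean, if_pos h, inv_mul_le_iff₀]
      · calc ∑ e : {e // E e ⊆ W}, finalMean E hE (W \ E e)
            ≤ ∑ _e : {e // E e ⊆ W}, (#W : ℝ) := sum_le_sum fun e _ =>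
              (ih _ (sdiff_ssubset e.2 (hE e))).trans
                (by exact_mod_cast card_le_card sdiff_subset)
          _ = _ := by simp [Fintype.card_subtype]
      · obtain ⟨e, he⟩ := h
        exact_mod_cast (card_pos.2 ⟨e, by simpa using he⟩)
    · rw [finalMean, if_neg h]

theorem transition_iterate_finalMean [Nonempty β] (hE : ∀ e, (E e).Nonempty) (m : ℕ) :
    (transition E)^[m] (finalMean E hE) = finalMean E hE := by
  refine Function.iterate_fixed ?_ m
  funext W
  rw [← sub_eq_zero, transition, ← expect_const (univ_nonempty (α := β)) (finalMean E hE W),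
    ← expect_sub_distrib, expect, sum_finalMean_step_sub, smul_zero]

variable [Fintype α] {n : ℕ}

/-- Given the edges examined so far, each of the other edges is equally likely to be the next. So
the number of vertices that are left unmatched in the end has the same conditional expectation
before and after the next edge is examined. -/
theorem sum_finalMean_examine_succ [DecidableEq β] (hE : ∀ e, (E e).Nonempty) {m : ℕ}
    (hm : m < n) :
    ∑ σ : β ≃ Fin n, finalMean E hE (examine E σ (m + 1)) =
      ∑ σ : β ≃ Fin n, finalMean E hE (examine E σ m) := by
  set Δ : Finset α → β → ℝ := fun W e => finalMean E hE (step E W e) - finalMean E hE W with hΔ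
  -- swap the next position `m` with a later position `j`
  have hswap : ∀ j : Fin n, m ≤ j →
      ∑ σ : β ≃ Fin n, Δ (examine E σ m) (σ.symm j) =
        ∑ σ : β ≃ Fin n, Δ (examine E σ m) (σ.symm ⟨m, hm⟩) := by
    intro j hj
    refine Fintype.sum_equiv ⟨fun σ => σ.trans (Equiv.swap ⟨m, hm⟩ j),
      fun σ => σ.trans (Equiv.swap ⟨m, hm⟩ j), fun σ => ?_, fun σ => ?_⟩ _ _ fun σ => ?_
    · ext x; simp
    · ext x; simp
    · simp [examine_swap σ (i := ⟨m, hm⟩) (j := j) le_rfl hj]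
  -- examined edges are not available any more, so they contribute nothing
  have hzero : ∀ σ : β ≃ Fin n,
      ∑ j ∈ univ.filter fun j : Fin n => m ≤ j, Δ (examine E σ m) (σ.symm j) = 0 := by
    intro σ
    rw [← sum_finalMean_step_sub hE (examine E σ m),
      ← Equiv.sum_comp σ.symm fun e => finalMean E hE (step E (examine E σ m) e) -
        finalMean E hE (examine E σ m)]
    refine sum_subset (filter_subset _ _) fun j _ hj => ?_
    have hj' : (j : ℕ) < m := by simpa using hj
    have h1 := not_subset_examine hE σ (e := σ.symm j) (m := m) (by simpa using hj')
    rw [hΔ]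
    simp only [step, if_neg h1, sub_self]
  have htot : (#(univ.filter fun j : Fin n => m ≤ j) : ℝ) *
      ∑ σ : β ≃ Fin n, Δ (examine E σ m) (σ.symm ⟨m, hm⟩) = 0 := by
    rw [← nsmul_eq_mul, ← sum_const, ← sum_congr rfl fun j hj => hswap j (by simpa using hj),
      sum_comm]
    exact sum_eq_zero fun σ _ => hzero σ
  have hcard : (#(univ.filter fun j : Fin n => m ≤ j) : ℝ) ≠ 0 := by
    exact_mod_cast (card_pos.2 ⟨(⟨m, hm⟩ : Fin n), by simp⟩).ne'
  have := (mul_eq_zero.1 htot).resolve_left hcard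
  simp only [hΔ, sum_sub_distrib] at this
  simp only [examine_succ _ hm]
  linarith

/-- The expected number of vertices left unmatched by the random greedy algorithm is at most the
expected number of unmatched vertices after any number of samples with replacement. -/
theorem expect_card_examine_le [Nonempty β] [DecidableEq β] (hE : ∀ e, (E e).Nonempty) (m : ℕ) :
    (𝔼 σ : β ≃ Fin (Fintype.card β), (#(examine E σ (Fintype.card β)) : ℝ)) ≤
      (transition E)^[m] (fun W => (#W : ℝ)) univ := by
  have hconst : ∀ i ≤ Fintype.card β,
      ∑ σ : β ≃ Fin (Fintype.card β), finalMean E hE (examine E σ i) =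
        ∑ _σ : β ≃ Fin (Fintype.card β), finalMean E hE univ := by
    intro i
    induction i with
    | zero => intro _; rfl
    | succ i ih =>
      intro hi
      rw [sum_finalMean_examine_succ hE hi, ih (Nat.le_of_succ_le hi)]
  have hfin : ∀ σ : β ≃ Fin (Fintype.card β), (#(examine E σ (Fintype.card β)) : ℝ) =
      finalMean E hE (examine E σ (Fintype.card β)) := fun σ =>
    (finalMean_of_forall_not_subset hE fun e => not_subset_examine hE σ (σ e).2).symm
  have : Nonempty (β ≃ Fin (Fintype.card β)) := ⟨Fintype.equivFin β⟩
  calc (𝔼 σ : β ≃ Fin (Fintype.card β), (#(examine E σ (Fintype.card β)) : ℝ))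
      = 𝔼 _σ : β ≃ Fin (Fintype.card β), finalMean E hE univ := by
        simp only [hfin, expect, hconst _ le_rfl]
    _ = (transition E)^[m] (finalMean E hE) univ := by
        rw [transition_iterate_finalMean, expect_const univ_nonempty]
    _ ≤ _ := transition_iterate_mono (finalMean_le_card hE) m univ

end Examine

/-! ### The `t`-subsets of `k`-sets -/

section Subsets

variable {v k t : ℕ}

/-- The `t`-subsets of a `k`-set, the edge of the hypergraph on the `t`-sets that corresponds to
the `k`-set. -/
def tSubsets (t : ℕ) (K : SubsetOfCard v k) : Finset (SubsetOfCard v t) :=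
  {T | T.1 ⊆ K.1}

theorem mem_tSubsets {K : SubsetOfCard v k} {T : SubsetOfCard v t} :
    T ∈ tSubsets t K ↔ T.1 ⊆ K.1 := by
  simp [tSubsets]

theorem card_supersets {S : Finset (Fin v)} (hS : #S ≤ k) :
    #{K : SubsetOfCard v k | S ⊆ K.1} = (v - #S).choose (k - #S) := by
  have h := card_filter_powersetCard_subset S univ k (subset_univ S) hS
  rw [card_univ, Fintype.card_fin] at h
  rw [← h, ← card_map (Function.Embedding.subtype _)]
  congr 1
  ext K
  simp [mem_powersetCard]
  tauto

theorem one_le_choose_sub_one (ht : 1 ≤ t) (htk : t < k) : 1 ≤ k.choose t - 1 := by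
  obtain ⟨k, rfl⟩ := Nat.exists_eq_add_one.2 (ht.trans htk.le)
  obtain ⟨t, rfl⟩ := Nat.exists_eq_add_one.2 ht
  have h1 := Nat.choose_pos (n := k) (k := t) (by omega)
  have h2 := Nat.choose_pos (n := k) (k := t + 1) (by omega)
  rw [Nat.choose_succ_succ']
  omega

theorem card_tSubsets (K : SubsetOfCard v k) : #(tSubsets t K) = k.choose t := by
  have h : (tSubsets t K).map (Function.Embedding.subtype _) = K.1.powersetCard t := by
    ext T
    simp [tSubsets, mem_powersetCard]
  rw [← card_map, h, card_powersetCard, K.2]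

theorem card_subsetOfCard : Fintype.card (SubsetOfCard v k) = v.choose k := by
  rw [Fintype.card_finset_len, Fintype.card_fin]

theorem pairProb_tSubsets (T T' : SubsetOfCard v t) (h : #(T.1 ∪ T'.1) ≤ k) :
    pairProb (tSubsets t (k := k)) T T' =
      ((v - #(T.1 ∪ T'.1)).choose (k - #(T.1 ∪ T'.1)) : ℝ) / v.choose k := by
  have h1 : ∀ K : SubsetOfCard v k, (T ∈ tSubsets t K ∧ T' ∈ tSubsets t K) ↔ T.1 ∪ T'.1 ⊆ K.1 :=
    fun K => by rw [mem_tSubsets, mem_tSubsets, union_subset_iff]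
  rw [← card_supersets h]
  unfold pairProb
  simp only [h1]
  rw [Fintype.expect_eq_sum_div_card, card_subsetOfCard, sum_boole]

/-- Two distinct `t`-sets are hardly ever in a common random `k`-set: their union has at least
`t + 1` elements. -/
theorem pairProb_tSubsets_le (htk : t < k) (hkv : k ≤ v) {T T' : SubsetOfCard v t} (h : T ≠ T') :
    pairProb (tSubsets t (k := k)) T T' ≤
      (k.choose t : ℝ) / v.choose t * ((k : ℝ) ^ 2 / v) := by
  have hne : ¬ T'.1 ⊆ T.1 := fun hs =>
    h (Subtype.ext (eq_of_subset_of_card_le hs (by rw [T.2, T'.2])).symm)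
  obtain ⟨x, hx', hx⟩ := not_subset.1 hne
  have hcard : #(insert x T.1) = t + 1 := by rw [card_insert_of_notMem hx, T.2]
  have hvk : (0 : ℝ) < v.choose k := by exact_mod_cast Nat.choose_pos hkv
  have hvt : (0 : ℝ) < v.choose t := by exact_mod_cast Nat.choose_pos (htk.le.trans hkv)
  have h1 : pairProb (tSubsets t (k := k)) T T' ≤
      ((v - (t + 1)).choose (k - (t + 1)) : ℝ) / v.choose k := by
    rw [← hcard, ← card_supersets (hcard.trans_le htk)]
    unfold pairProb
    rw [Fintype.expect_eq_sum_div_card, card_subsetOfCard, sum_boole]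
    gcongr with K
    rw [mem_tSubsets, mem_tSubsets]
    exact fun hK => insert_subset (hK.2 hx') hK.1
  refine h1.trans ?_
  have h2 : (v.choose k : ℝ) * k.choose t = v.choose t * (v - t).choose (k - t) := by
    exact_mod_cast Nat.choose_mul htk.le
  have h3 : ((v : ℝ) - t) * (v - (t + 1)).choose (k - (t + 1)) =
      (v - t).choose (k - t) * ((k : ℝ) - t) := by
    have h4 := Nat.add_one_mul_choose_eq (v - (t + 1)) (k - (t + 1))
    rw [show v - (t + 1) + 1 = v - t by omega, show k - (t + 1) + 1 = k - t by omega] at h4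
    rw [← Nat.cast_sub (htk.le.trans hkv), ← Nat.cast_sub htk.le]
    exact_mod_cast h4
  have hkt : (t : ℝ) + 1 ≤ k := by exact_mod_cast htk
  have hkv' : (k : ℝ) ≤ v := by exact_mod_cast hkv
  have ht0 : (0 : ℝ) ≤ t := Nat.cast_nonneg t
  have hv0 : (0 : ℝ) < v := by linarith
  set a := (((v - (t + 1)).choose (k - (t + 1)) : ℕ) : ℝ)
  set b := (((v - t).choose (k - t) : ℕ) : ℝ)
  have ha0 : 0 ≤ a := Nat.cast_nonneg _
  have hb0 : 0 ≤ b := Nat.cast_nonneg _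
  -- `v - t ≥ v / k`, so `a ≤ b * (k - t) * k / v`
  have h5 : a * v ≤ b * (k : ℝ) ^ 2 := by
    have h6 : (v : ℝ) ≤ k * ((v : ℝ) - t) := by nlinarith
    calc a * v ≤ a * (k * ((v : ℝ) - t)) := by gcongr
      _ = k * (b * ((k : ℝ) - t)) := by rw [← h3]; ring
      _ ≤ k * (b * k) := by gcongr; linarith
      _ = b * (k : ℝ) ^ 2 := by ring
  rw [div_mul_div_comm, div_le_div_iff₀ hvk (by positivity)]
  calc a * (v.choose t * v) = v.choose t * (a * v) := by ring
    _ ≤ v.choose t * (b * (k : ℝ) ^ 2) := by gcongr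
    _ = (v.choose t * b) * (k : ℝ) ^ 2 := by ring
    _ = _ := by rw [← h2]; ring

theorem isSparse_tSubsets (htk : t < k) (hkv : k ≤ v) :
    IsSparse (tSubsets t : SubsetOfCard v k → _) (k.choose t - 1)
      ((k.choose t : ℝ) / v.choose t) ((k.choose t : ℝ) / v.choose t * ((k : ℝ) ^ 2 / v)) where
  card_eq K := by
    rw [card_tSubsets, Nat.sub_add_cancel (Nat.choose_pos htk.le)]
  pairProb_self T := by
    have hvk : (v.choose k : ℝ) ≠ 0 := by exact_mod_cast (Nat.choose_pos hkv).ne'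
    have hvt : (v.choose t : ℝ) ≠ 0 := by exact_mod_cast (Nat.choose_pos (htk.le.trans hkv)).ne'
    have hu : #(T.1 ∪ T.1) = t := by rw [union_self, T.2]
    rw [pairProb_tSubsets T T (hu.trans_le htk.le), hu, div_eq_div_iff hvk hvt]
    have h2 : (v.choose k : ℝ) * k.choose t = v.choose t * (v - t).choose (k - t) := by
      exact_mod_cast Nat.choose_mul htk.le
    linarith
  pairProb_le _ _ h := pairProb_tSubsets_le htk hkv h

/-- The action of a permutation of the `v`-set on its `k`-subsets. -/
def permSubsets (k : ℕ) (τ : Equiv.Perm (Fin v)) : Equiv.Perm (SubsetOfCard v k) where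
  toFun K := ⟨K.1.map τ.toEmbedding, (card_map _).trans K.2⟩
  invFun K := ⟨K.1.map τ.symm.toEmbedding, (card_map _).trans K.2⟩
  left_inv K := Subtype.ext (by ext; simp)
  right_inv K := Subtype.ext (by ext; simp)

theorem exists_perm_tSubsets (T T' : SubsetOfCard v t) :
    ∃ π : Equiv.Perm (SubsetOfCard v t), ∃ ρ : Equiv.Perm (SubsetOfCard v k), π T = T' ∧
      ∀ K, tSubsets t (ρ K) = (tSubsets t K).map π.toEmbedding := by
  obtain ⟨τ, hτ⟩ := (Set.powersetCard.isPretransitive (α := Fin v) (n := t)).exists_smul_eq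
    ⟨T.1, T.2⟩ ⟨T'.1, T'.2⟩
  refine ⟨permSubsets t τ, permSubsets k τ, ?_, fun K => ?_⟩
  · have h := congrArg Subtype.val hτ
    rw [Set.powersetCard.coe_smul] at h
    refine Subtype.ext (Eq.trans ?_ h)
    simp [permSubsets, map_eq_image, smul_finset_def]
  · ext S
    rw [mem_map_equiv, mem_tSubsets, mem_tSubsets]
    exact map_symm_subset.symm

end Subsets

/-! ### The greedy selection examines the `k`-sets in order -/

section Greedy

variable {v k t : ℕ}

/-- The `t`-sets that are not covered by the `k`-sets in `A`. -/
def uncoveredBy (t : ℕ) (A : Finset (SubsetOfCard v k)) : Finset (SubsetOfCard v t) :=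
  {T | ¬ ∃ B ∈ A, T.1 ⊆ B.1}

theorem mem_available {A : Finset (SubsetOfCard v k)} {K : SubsetOfCard v k} :
    K ∈ available t A ↔ tSubsets t K ⊆ uncoveredBy t A := by
  simp only [available, mem_filter_univ, subset_iff, mem_tSubsets, uncoveredBy, mem_powersetCard]
  exact ⟨fun h T hT => h T.1 ⟨hT, T.2⟩, fun h T hT => @h ⟨T, hT.2⟩ hT.1⟩

theorem uncoveredBy_insert (A : Finset (SubsetOfCard v k)) (K : SubsetOfCard v k) :
    uncoveredBy t (insert K A) = uncoveredBy t A \ tSubsets t K := by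
  ext T
  simp [uncoveredBy, mem_tSubsets]
  tauto

theorem tSubsets_nonempty (htk : t ≤ k) (K : SubsetOfCard v k) : (tSubsets t K).Nonempty :=
  card_pos.1 (by rw [card_tSubsets]; exact Nat.choose_pos htk)

/-- Every state of the examination of the `k`-sets in their order is a state of the greedy
selection. -/
theorem exists_iterate_greedyStep (htk : t ≤ k) (σ : BlockOrder v k) (m : ℕ)
    (hm : m ≤ Fintype.card (SubsetOfCard v k)) :
    ∃ n ≤ m, uncoveredBy t ((greedyStep t σ)^[n] ∅) = examine (tSubsets t) σ m := by
  induction m with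
  | zero =>
    refine ⟨0, le_rfl, ?_⟩
    simp [uncoveredBy, examine]
  | succ m ih =>
    obtain ⟨n, hnm, hn⟩ := ih (Nat.le_of_succ_le hm)
    rw [examine_succ σ hm, step]
    set K := σ.symm ⟨m, hm⟩ with hK
    split_ifs with hsub
    swap
    · exact ⟨n, by omega, hn⟩
    refine ⟨n + 1, by omega, ?_⟩
    rw [Function.iterate_succ_apply']
    set A := (greedyStep t σ)^[n] ∅
    have hKA : K ∈ available t A := mem_available.2 (hn ▸ hsub)
    have hne : (available t A).Nonempty := ⟨K, hKA⟩
    -- the available sets are at positions from `m` on, so `K` is the earliest of them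
    have hearliest : earliest σ (available t A) hne = K := by
      rw [earliest, hK]
      congr 1
      refine le_antisymm (min'_le _ _ (mem_image.2 ⟨K, hKA, by simp [hK]⟩)) (le_min' _ _ _ ?_)
      intro i hi
      obtain ⟨K', hK', rfl⟩ := mem_image.1 hi
      by_contra hlt
      exact not_subset_examine (tSubsets_nonempty htk) σ (e := K') (m := m) (not_le.1 hlt)
        (hn ▸ mem_available.1 hK')
    rw [greedyStep, dif_pos hne, hearliest, uncoveredBy_insert, hn]

theorem uncovered_eq_examine (htk : t ≤ k) (σ : BlockOrder v k) :
    uncovered t σ = examine (tSubsets t) σ (Fintype.card (SubsetOfCard v k)) := by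
  obtain ⟨n, hn, h⟩ := exists_iterate_greedyStep htk σ _ le_rfl
  set A := (greedyStep t σ)^[n] ∅ with hA
  have havail : available t A = ∅ := by
    rw [eq_empty_iff_forall_notMem]
    intro K hK
    exact not_subset_examine (tSubsets_nonempty htk) σ (σ K).2 (h ▸ mem_available.1 hK)
  have hfix : greedyStep t σ A = A := by
    rw [greedyStep, dif_neg (by rw [havail]; exact not_nonempty_empty)]
  have hchosen : chosen t σ = A := by
    rw [chosen, ← Nat.sub_add_cancel hn, Function.iterate_add_apply, ← hA]
    exact Function.iterate_fixed hfix _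
  rw [← h, ← hchosen]
  rfl

/-! ### The density of the greedy covering -/

/-- The chosen `k`-sets form a packing: no `t`-set is covered twice. -/
theorem card_uncoveredBy_add (htk : t ≤ k) (σ : BlockOrder v k) (n : ℕ) :
    #(uncoveredBy t ((greedyStep t σ)^[n] ∅)) + k.choose t * #((greedyStep t σ)^[n] ∅) =
      v.choose t := by
  induction n with
  | zero =>
    have h : uncoveredBy t (∅ : Finset (SubsetOfCard v k)) = univ := by simp [uncoveredBy]
    simp only [Function.iterate_zero, id_eq, h, card_empty, mul_zero, add_zero]
    rw [card_univ, card_subsetOfCard]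
  | succ n ih =>
    rw [Function.iterate_succ_apply']
    set A := (greedyStep t σ)^[n] ∅
    unfold greedyStep
    split_ifs with h
    · have hmem := earliest_mem σ _ h
      have hle := card_le_card (mem_available.1 hmem)
      rw [card_insert_of_notMem (notMem_of_mem_available htk hmem), uncoveredBy_insert,
        card_sdiff_of_subset (mem_available.1 hmem), card_tSubsets]
      rw [card_tSubsets] at hle
      rw [← ih, mul_add]
      omega
    · exact ih

/-- Only the uncovered `t`-sets push the density above `1`. -/
theorem density_greedyCovering (htk : t ≤ k) (hkv : k ≤ v) (c : CoverUpRule v k t)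
    (σ : BlockOrder v k) :
    (greedyCovering c σ).density =
      1 + ((k.choose t : ℝ) - 1) * (#(uncovered t σ) / v.choose t) := by
  have hvt : (v.choose t : ℝ) ≠ 0 := by exact_mod_cast (Nat.choose_pos (htk.trans hkv)).ne'
  have hcount : ∀ T : SubsetOfCard v t,
      (greedyCovering c σ).blocks.countP (fun B => T.1 ⊆ B.1) =
        ∑ B ∈ chosen t σ, (if T ∈ tSubsets t B then 1 else 0) +
          ∑ S ∈ uncovered t σ, if T ∈ tSubsets t (c.cover σ S) then 1 else 0 := by
    intro T
    simp only [mem_tSubsets, ← card_filter]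
    rw [greedyCovering, Multiset.countP_add, Multiset.countP_map, Multiset.countP_eq_card_filter]
    rfl
  have hsum : ∑ T : SubsetOfCard v t, (greedyCovering c σ).blocks.countP (fun B => T.1 ⊆ B.1) =
      #(chosen t σ) * k.choose t + #(uncovered t σ) * k.choose t := by
    simp only [hcount]
    rw [sum_add_distrib, sum_comm, sum_comm (s := univ) (t := uncovered t σ)]
    simp [card_tSubsets]
  have hpack : (#(uncovered t σ) : ℝ) + k.choose t * #(chosen t σ) = v.choose t := by
    exact_mod_cast card_uncoveredBy_add htk σ (Fintype.card (SubsetOfCard v k))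
  rw [Covering.density, Fintype.expect_eq_sum_div_card, card_subsetOfCard, ← Nat.cast_sum, hsum]
  push_cast
  rw [div_eq_iff hvt, add_mul, mul_assoc, div_mul_cancel₀ _ hvt, ← hpack]
  ring

theorem expectedDensity_eq (htk : t ≤ k) (hkv : k ≤ v) (c : CoverUpRule v k t) :
    expectedDensity c = 1 + ((k.choose t : ℝ) - 1) *
      ((𝔼 σ : BlockOrder v k, (#(uncovered t σ) : ℝ)) / v.choose t) := by
  have : Nonempty (BlockOrder v k) := ⟨Fintype.equivFin _⟩
  simp only [expectedDensity, density_greedyCovering htk hkv]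
  rw [expect_add_distrib, expect_const univ_nonempty, ← mul_expect, ← expect_div]

/-- The expected proportion of uncovered `t`-sets is bounded by the survival probability of a
`t`-set when `n` random `k`-sets are examined, for every `n`. -/
theorem exists_survival_bound (htk : t < k) (ht : 1 ≤ t) (hkv : k ≤ v) (n : ℕ) :
    ∃ u : ℝ, (𝔼 σ : BlockOrder v k, (#(uncovered t σ) : ℝ)) / v.choose t ≤ u ∧ 0 ≤ u ∧ u ≤ 1 ∧
      (u ^ (k.choose t - 1 + 1) ≤ 2 * (((k.choose t - 1 : ℕ) + 1) ^ 2 *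
        correlationError (k.choose t - 1) ((k.choose t : ℝ) / v.choose t)
          ((k.choose t : ℝ) / v.choose t * ((k : ℝ) ^ 2 / v)) n) ∨
        u ^ (k.choose t - 1) * (n * ((k.choose t : ℝ) / v.choose t)) ≤ 2) := by
  have hvt : (0 : ℝ) < v.choose t := by exact_mod_cast Nat.choose_pos (htk.le.trans hkv)
  have hβ : Nonempty (SubsetOfCard v k) :=
    Fintype.card_pos_iff.1 (by rw [card_subsetOfCard]; exact Nat.choose_pos hkv)
  obtain ⟨T⟩ : Nonempty (SubsetOfCard v t) :=
    Fintype.card_pos_iff.1 (by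
      rw [card_subsetOfCard]; exact Nat.choose_pos (htk.le.trans hkv))
  have hD := one_le_choose_sub_one ht htk
  obtain ⟨u, hu, hu0, hu1, hor⟩ := (isSparse_tSubsets htk hkv).survival_le hD (by positivity)
    (by positivity) exists_perm_tSubsets T n
  refine ⟨u, ?_, hu0, hu1, hor⟩
  rw [div_le_iff₀ hvt]
  have hcard : (fun W : Finset (SubsetOfCard v t) => (#W : ℝ)) =
      fun W => ∑ T, allUnmatched {T} W := by
    funext W
    simp [allUnmatched]
  calc (𝔼 σ : BlockOrder v k, (#(uncovered t σ) : ℝ))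
      ≤ (transition (tSubsets t : SubsetOfCard v k → _))^[n]
          (fun W : Finset (SubsetOfCard v t) => (#W : ℝ)) univ := by
        simp only [uncovered_eq_examine htk.le]
        exact expect_card_examine_le (tSubsets_nonempty htk.le) n
    _ = u * v.choose t := by
        rw [hcard, transition_iterate_sum]
        simp only [hu, sum_const, card_univ, card_subsetOfCard, nsmul_eq_mul]
        exact mul_comm _ _

end Greedy

/-! ### Choosing the number of samples -/

/-- With `y = O(1 / v)` and `δ = O(1 / v)`, the correlation error is at most a negative
power of `v`, up to a constant, as long as `n * y` is at most a small multiple of `log v`. -/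
theorem correlationError_le {D : ℕ} {y δ : ℝ} (hy : 0 ≤ y) (hy1 : y ≤ 1) (hδ : 0 ≤ δ) (n : ℕ) :
    correlationError D y (y * δ) n ≤
      Real.exp ((2 * D + 2) * (n * y)) * ((D + 3) * δ + y) := by
  set x := n * y with hx
  have hx0 : 0 ≤ x := by positivity
  have hpow : ((1 + D * y) ^ n) ^ 2 ≤ Real.exp (2 * D * x) := by
    have h1 : 1 + D * y ≤ Real.exp (D * y) := by linarith [Real.add_one_le_exp (D * y)]
    calc ((1 + D * y) ^ n) ^ 2 ≤ (Real.exp (D * y) ^ n) ^ 2 := by gcongr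
      _ = Real.exp (2 * D * x) := by
        rw [← Real.exp_nat_mul, ← Real.exp_nat_mul, hx]
        congr 1
        push_cast
        ring
  have hxe : x ≤ Real.exp x := by linarith [Real.add_one_le_exp x]
  have h1e : 1 ≤ Real.exp x := Real.one_le_exp hx0
  have hquad : x * (x * (2 + D * y) * δ + (δ + y)) ≤
      Real.exp x ^ 2 * ((D + 3) * δ + y) := by
    have h1 : x * x ≤ Real.exp x ^ 2 := by rw [sq]; gcongr
    have h2 : x ≤ Real.exp x ^ 2 := by nlinarith
    have h3 : x * x * ((2 + D * y) * δ) ≤ Real.exp x ^ 2 * ((2 + D * 1) * δ) := by gcongr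
    have h4 : x * (δ + y) ≤ Real.exp x ^ 2 * (δ + y) := by gcongr
    linarith
  calc correlationError D y (y * δ) n
      = x * (x * (2 + D * y) * δ + (δ + y)) * ((1 + D * y) ^ n) ^ 2 := by
        rw [correlationError, hx]
        ring
    _ ≤ Real.exp x ^ 2 * ((D + 3) * δ + y) * Real.exp (2 * D * x) := by gcongr
    _ = Real.exp ((2 * D + 2) * x) * ((D + 3) * δ + y) := by
        rw [← Real.exp_nat_mul, mul_right_comm, ← Real.exp_add]
        congr 2
        push_cast
        ring

theorem le_choose_of_pos_of_lt {t v : ℕ} (ht : 1 ≤ t) (htv : t < v) : v ≤ v.choose t := by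
  induction v, htv using Nat.le_induction with
  | base => simp
  | succ v hv ih =>
    obtain ⟨t, rfl⟩ := Nat.exists_eq_add_one.2 ht
    rw [Nat.choose_succ_succ']
    have := Nat.choose_pos (n := v) (k := t) (by omega)
    omega

/-- The expected proportion of uncovered `t`-sets is `O((log v) ^ (-1 / D))`, stated without
fractional powers. -/
theorem exists_pow_mul_log_le (k t : ℕ) (ht : 1 ≤ t) (htk : t < k) :
    ∃ C : ℝ, 0 ≤ C ∧ ∀ v : ℕ, k ≤ v → ∃ u : ℝ,
      (𝔼 σ : BlockOrder v k, (#(uncovered t σ) : ℝ)) / v.choose t ≤ u ∧ 0 ≤ u ∧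
        u ^ (k.choose t - 1) * Real.log v ≤ C := by
  have hD := one_le_choose_sub_one ht htk
  have hr : (k.choose t : ℝ) = ((k.choose t - 1 : ℕ) : ℝ) + 1 := by
    rw [Nat.cast_sub (by omega)]
    simp
  set D := k.choose t - 1 with hDdef
  set K : ℝ := 2 * ((D + 1) ^ 2 * (Real.exp (2 * D + 2) * ((D + 3) * (k : ℝ) ^ 2 + (D + 1))))
    with hK
  refine ⟨16 * K + 1 + (8 * D + 8), by positivity, fun v hkv => ?_⟩
  have htv : t < v := htk.trans_le hkv
  have hv0 : (0 : ℝ) < v := by exact_mod_cast (by omega : 0 < v)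
  have hv1 : (1 : ℝ) ≤ v := by exact_mod_cast (by omega : 1 ≤ v)
  have hN0 : (0 : ℝ) < v.choose t := by exact_mod_cast Nat.choose_pos htv.le
  have hvN : (v : ℝ) ≤ v.choose t := by exact_mod_cast le_choose_of_pos_of_lt ht htv
  set y : ℝ := (k.choose t : ℝ) / v.choose t with hy
  have hy0 : 0 < y := by rw [hy, hr]; positivity
  have hy1 : y ≤ 1 := by
    rw [hy, div_le_one hN0]
    exact_mod_cast Nat.choose_le_choose t hkv
  have hyv : y ≤ (D + 1) / v := by
    rw [hy, hr]
    gcongr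
  set L := Real.log v with hL
  have hL0 : 0 ≤ L := Real.log_nonneg hv1
  have hvL : (v : ℝ) = Real.exp L := (Real.exp_log hv0).symm
  -- with `n * y ≈ L / (4 * D + 4)` samples, the correlation error is about `v ^ (-1 / 2)`
  set X := L / (4 * D + 4) with hX
  set n := ⌈X / y⌉₊ with hn
  have hX0 : 0 ≤ X := by positivity
  have hle : X ≤ n * y := (div_le_iff₀ hy0).1 (Nat.le_ceil _)
  have hge : n * y ≤ X + 1 := by
    have h1 := (Nat.ceil_lt_add_one (div_nonneg hX0 hy0.le)).le
    calc n * y ≤ (X / y + 1) * y := by gcongr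
      _ = X + y := by field_simp
      _ ≤ X + 1 := by gcongr
  have herr : 2 * ((D + 1) ^ 2 * correlationError D y (y * ((k : ℝ) ^ 2 / v)) n) ≤
      K * Real.exp (-L / 2) := by
    have h1 := correlationError_le (D := D) hy0.le hy1 (δ := (k : ℝ) ^ 2 / v) (by positivity) n
    have h2 : Real.exp ((2 * D + 2) * (n * y)) ≤ Real.exp (2 * D + 2) * Real.exp (L / 2) := by
      rw [← Real.exp_add, Real.exp_le_exp]
      calc (2 * D + 2) * (n * y) ≤ (2 * D + 2) * (X + 1) := by gcongr
        _ = 2 * D + 2 + L / 2 := by rw [hX]; field_simp; ring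
    have h3 : (D + 3) * ((k : ℝ) ^ 2 / v) + y ≤
        ((D + 3) * (k : ℝ) ^ 2 + (D + 1)) * Real.exp (-L) := by
      rw [Real.exp_neg, ← hvL, ← div_eq_mul_inv, add_div, mul_div_assoc]
      gcongr
    have h4 : Real.exp (-L / 2) = Real.exp (L / 2) * Real.exp (-L) := by
      rw [← Real.exp_add]
      congr 1
      ring
    calc 2 * ((D + 1) ^ 2 * correlationError D y (y * ((k : ℝ) ^ 2 / v)) n)
        ≤ 2 * ((D + 1) ^ 2 * (Real.exp (2 * D + 2) * Real.exp (L / 2) *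
            (((D + 3) * (k : ℝ) ^ 2 + (D + 1)) * Real.exp (-L)))) := by
          gcongr
          exact h1.trans (by gcongr)
      _ = K * Real.exp (-L / 2) := by rw [h4, hK]; ring
  have hK0 : 0 ≤ K := by positivity
  obtain ⟨u, hu, hu0, hu1, hor⟩ := exists_survival_bound htk ht hkv n
  refine ⟨u, hu, hu0, ?_⟩
  rcases hor with h | h
  · -- here `u` is as small as a power of `v`
    have h1 : (u ^ D) ^ 2 ≤ K * Real.exp (-L / 2) := by
      rw [← pow_mul]
      exact (pow_le_pow_of_le_one hu0 hu1 (by omega)).trans (h.trans herr)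
    have h2 : L ^ 2 ≤ 16 * Real.exp (L / 2) := by
      have h3 : L ≤ 4 * Real.exp (L / 4) := by linarith [Real.add_one_le_exp (L / 4)]
      calc L ^ 2 ≤ (4 * Real.exp (L / 4)) ^ 2 := by gcongr
        _ = 16 * Real.exp (L / 2) := by
          rw [mul_pow, ← Real.exp_nat_mul]
          norm_num
          ring
    have h3 : (u ^ D * L) ^ 2 ≤ 16 * K := by
      calc (u ^ D * L) ^ 2 = (u ^ D) ^ 2 * L ^ 2 := mul_pow _ _ _
        _ ≤ (K * Real.exp (-L / 2)) * (16 * Real.exp (L / 2)) := by gcongr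
        _ = 16 * K * (Real.exp (-L / 2) * Real.exp (L / 2)) := by ring
        _ = 16 * K := by
          rw [← Real.exp_add, neg_div, neg_add_cancel, Real.exp_zero, mul_one]
    have hD0 : (0 : ℝ) ≤ D := Nat.cast_nonneg D
    nlinarith [sq_nonneg (u ^ D * L - 1)]
  · have h1 : u ^ D * X ≤ 2 := (mul_le_mul_of_nonneg_left hle (by positivity)).trans h
    have h2 : u ^ D * L = u ^ D * X * (4 * D + 4) := by
      rw [hX]
      field_simp
    have h3 : u ^ D * X * (4 * D + 4) ≤ 2 * (4 * D + 4) := by gcongr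
    linarith

end RandomGreedy

theorem mainTheorem2 (k t : ℕ) (ht : 1 ≤ t) (htk : t < k) :
    ∃ C : ℝ, ∀ v : ℕ, k ≤ v → ∀ c : RandomGreedy.CoverUpRule v k t,
      |RandomGreedy.expectedDensity c - 1| ≤
        C * (Real.log v) ^ (-1 / ((k.choose t : ℝ) - 1)) := by
  obtain ⟨C, hC0, hC⟩ := RandomGreedy.exists_pow_mul_log_le k t ht htk
  have hD := RandomGreedy.one_le_choose_sub_one ht htk
  have hr : (k.choose t : ℝ) - 1 = ((k.choose t - 1 : ℕ) : ℝ) := by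
    rw [Nat.cast_sub (by omega)]
    simp
  set D := k.choose t - 1
  refine ⟨D * C ^ (1 / D : ℝ), fun v hkv c => ?_⟩
  obtain ⟨u, hu, hu0, hpow⟩ := hC v hkv
  have hL : 0 < Real.log v := Real.log_pos (by exact_mod_cast (by omega : 1 < v))
  have hmean : 0 ≤ (𝔼 σ : RandomGreedy.BlockOrder v k, (#(RandomGreedy.uncovered t σ) : ℝ)) /
      v.choose t := div_nonneg (expect_nonneg fun _ _ => Nat.cast_nonneg _) (Nat.cast_nonneg _)
  have hu' : u ≤ C ^ (1 / D : ℝ) * Real.log v ^ (-1 / D : ℝ) := by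
    calc u = (u ^ D) ^ (1 / D : ℝ) := by
          rw [one_div, Real.pow_rpow_inv_natCast hu0 (by omega)]
      _ ≤ (C / Real.log v) ^ (1 / D : ℝ) := by
          gcongr
          exact (le_div_iff₀ hL).2 hpow
      _ = C ^ (1 / D : ℝ) * Real.log v ^ (-1 / D : ℝ) := by
          rw [Real.div_rpow hC0 hL.le, neg_div, Real.rpow_neg hL.le, div_eq_mul_inv]
  rw [RandomGreedy.expectedDensity_eq htk.le hkv c, add_sub_cancel_left, hr,
    abs_of_nonneg (mul_nonneg (Nat.cast_nonneg D) hmean), mul_assoc]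
  exact mul_le_mul_of_nonneg_left (hu.trans hu') (Nat.cast_nonneg D)
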